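/- Let $n\ge 0$, let $\langle\cdot,\cdot\rangle$ be the standard inner product on $\mathbb R^{n+1}$, and let $\mathbb S^n\subset\mathbb R^{n+1}$ be the unit sphere, regarded as the double cover of $\mathbb{RP}^n$. A set $S\subset\mathbb{RP}^n$ is *convex* if every pair of points of $S$ is contained in a segment (possibly reduced to a point) of a projective line that lies in $S$. It is *properly convex* if in addition $S$ is open and $\operatorname{cl}S$ contains no projective line. A set $\Omega\subset\mathbb S^n$ is *properly convex* if it is a lift of a properly convex set $S\subset\mathbb{RP}^n$, that is, the image of a continuous section over $S$ of the double cover $\mathbb S^n\to\mathbb{RP}^n$. The *dual* of $\Omega\subset\mathbb S^n$ is $\Omega^*=\{y\in\mathbb S^n:\langle x,y\rangle>0\ \text{for all } x\in\operatorname{cl}\Omega\}$. For $y\in\mathbb S^n$ put $U_y=\{x\in\mathbb S^n:\langle x,y\rangle>0\}$, and let $$\pi_y:U_y\to T_y\mathbb S^n=y^\perp,\qquad \pi_y(x)=\frac{x-\langle x,y\rangle y}{\langle x,y\rangle}$$ be radial projection, so that $\pi_y(y)=0$. The *centroid* of a Lebesgue measurable subset $A$ of a Euclidean space, of finite positive Lebesgue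 measure and with $x$ integrable on $A$, is $\hat\mu(A)=\int_A x\,d\mathrm{vol}\big/\int_A d\mathrm{vol}$. A point $y\in\Omega^*$ is a *center* of $\Omega$ if $\pi_y(\Omega)$ is measurable with finite positive Lebesgue measure, $x$ is integrable on it, and $\hat\mu(\pi_y(\Omega))=\pi_y(y)=0$. **Theorem.** If $\Omega\subset\mathbb S^n$ is properly convex and has nonempty interior, then $\Omega$ has a center $p\in\Omega$ (so $p\in\Omega\cap\Omega^*$). -/

import Mathlib

open MeasureTheory
open scoped LinearAlgebra.Projectivization

noncomputable section

namespace SphericalCenter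

/-- The Euclidean space `ℝⁿ⁺¹`. -/
abbrev Euc (n : ℕ) : Type := EuclideanSpace ℝ (Fin (n + 1))

/-- The unit sphere `𝕊ⁿ ⊂ ℝⁿ⁺¹`. -/
abbrev Sph (n : ℕ) : Type := Metric.sphere (0 : Euc n) 1

/-- Real projective space `ℝPⁿ`. -/
abbrev RP (n : ℕ) : Type := ℙ ℝ (Euc n)

theorem sph_ne_zero {n : ℕ} (x : Sph n) : (x : Euc n) ≠ 0 :=
  ne_zero_of_mem_unit_sphere x

/-- The double cover `𝕊ⁿ → ℝPⁿ`. -/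
def cover {n : ℕ} (x : Sph n) : RP n :=
  Projectivization.mk ℝ (x : Euc n) (sph_ne_zero x)

/-- `ℝPⁿ` carries the quotient topology from `𝕊ⁿ`. -/
instance {n : ℕ} : TopologicalSpace (RP n) :=
  TopologicalSpace.coinduced (cover (n := n)) inferInstance

/-- Projective lines in `ℝPⁿ`: the points lying in a given plane of `ℝⁿ⁺¹`. -/
def IsProjLine {n : ℕ} (L : Set (RP n)) : Prop :=
  ∃ W : Submodule ℝ (Euc n), Module.finrank ℝ W = 2 ∧ L = {q | q.submodule ≤ W}

/-- Closed segments of projective lines, a single point being a degenerate segment. The two segments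
with distinct endpoints `[u]` and `[v]` are the images of the cones on `u, v` and on `u, -v`. -/
def IsProjSegment {n : ℕ} (σ : Set (RP n)) : Prop :=
  ∃ u v : Euc n, u ≠ 0 ∧ v ≠ 0 ∧
    σ = {q | ∃ s t : ℝ, 0 ≤ s ∧ 0 ≤ t ∧
      ∃ h : s • u + t • v ≠ 0, q = Projectivization.mk ℝ (s • u + t • v) h}

/-- A subset of `ℝPⁿ` is convex if any two of its points lie in a segment of a projective line that
is contained in the set. -/
def IsProjConvex {n : ℕ} (S : Set (RP n)) : Prop :=
  ∀ a ∈ S, ∀ b ∈ S, ∃ σ : Set (RP n), IsProjSegment σ ∧ a ∈ σ ∧ b ∈ σ ∧ σ ⊆ S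

/-- A subset of `ℝPⁿ` is properly convex if it is convex and open, and its closure contains no
projective line. -/
structure IsProjProperlyConvex {n : ℕ} (S : Set (RP n)) : Prop where
  convex : IsProjConvex S
  isOpen : IsOpen S
  noLine : ∀ L : Set (RP n), IsProjLine L → ¬ L ⊆ closure S

/-- `Ω ⊆ 𝕊ⁿ` is a lift of `S ⊆ ℝPⁿ`: the image of a continuous section over `S` of the double
cover. -/
def IsLift {n : ℕ} (Ω : Set (Sph n)) (S : Set (RP n)) : Prop :=
  ∃ f : RP n → Sph n, ContinuousOn f S ∧ (∀ q ∈ S, cover (f q) = q) ∧ Ω = f '' S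

/-- A subset of `𝕊ⁿ` is properly convex if it is a lift of a properly convex subset of `ℝPⁿ`. -/
def IsProperlyConvex {n : ℕ} (Ω : Set (Sph n)) : Prop :=
  ∃ S : Set (RP n), IsProjProperlyConvex S ∧ IsLift Ω S

/-- The dual `Ω* = {y ∈ 𝕊ⁿ : ⟨x, y⟩ > 0 for all x ∈ cl Ω}`. -/
def dual {n : ℕ} (Ω : Set (Sph n)) : Set (Sph n) :=
  {y | ∀ x ∈ closure Ω, 0 < inner ℝ (x : Euc n) (y : Euc n)}

/-- The tangent space `T_y 𝕊ⁿ`, identified with `y^⊥ ⊂ ℝⁿ⁺¹` with the induced inner product. -/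
abbrev Tangent {n : ℕ} (y : Sph n) : Submodule ℝ (Euc n) := (ℝ ∙ (y : Euc n))ᗮ

theorem radial_mem {n : ℕ} (y x : Sph n) :
    (inner ℝ (x : Euc n) (y : Euc n))⁻¹ •
      ((x : Euc n) - inner ℝ (x : Euc n) (y : Euc n) • (y : Euc n)) ∈ Tangent y := by
  apply Submodule.smul_mem
  rw [Submodule.mem_orthogonal_singleton_iff_inner_right, inner_sub_right, inner_smul_right,
    real_inner_self_eq_norm_sq, norm_eq_of_mem_sphere y, real_inner_comm]
  ring

/-- Radial projection `π_y(x) = (x - ⟨x, y⟩ y) / ⟨x, y⟩`, meaningful on the open hemisphere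
`U_y = {x : ⟨x, y⟩ > 0}`. -/
def radialProj {n : ℕ} (y x : Sph n) : Tangent y :=
  ⟨(inner ℝ (x : Euc n) (y : Euc n))⁻¹ •
    ((x : Euc n) - inner ℝ (x : Euc n) (y : Euc n) • (y : Euc n)), radial_mem y x⟩

theorem radialProj_self {n : ℕ} (y : Sph n) : radialProj y y = 0 := by
  apply Subtype.ext
  simp [radialProj]

/-- `A` has a centroid, and it is `c`: `A` is Lebesgue measurable with finite positive Lebesgue
measure, `x` is integrable on `A`, and `c = (∫_A x dvol) / (∫_A dvol)`. -/
structure HasCentroid {F : Type*} [NormedAddCommGroup F] [InnerProductSpace ℝ F]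
    [FiniteDimensional ℝ F] [MeasurableSpace F] [BorelSpace F] (A : Set F) (c : F) : Prop where
  nullMeasurable : NullMeasurableSet A (volume : Measure F)
  volume_pos : 0 < (volume : Measure F) A
  volume_lt_top : (volume : Measure F) A < ⊤
  integrable : IntegrableOn (fun x : F => x) A volume
  eq : c = ((volume : Measure F) A).toReal⁻¹ • ∫ x in A, x

/-- `y` is a center of `Ω`: `y ∈ Ω*` and the centroid of `π_y(Ω)` is `π_y(y)`. -/
structure IsCenter {n : ℕ} (Ω : Set (Sph n)) (y : Sph n) : Prop where
  mem_dual : y ∈ dual Ω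
  centroid : HasCentroid (radialProj y '' Ω) (radialProj y y)

end SphericalCenter

end

open Filter Set Topology

namespace SphericalCenter

/-! ### Minimizing the Laplace transform of a cone over the unit sphere -/

section Analysis

variable {E : Type*} [NormedAddCommGroup E] [InnerProductSpace ℝ E] [FiniteDimensional ℝ E]
  [MeasurableSpace E] [BorelSpace E]


/-! Let `C` be the open cone over `Ω`. Convexity and the absence of projective lines in `cl S` make
`C` convex with salient closure, so some `y` is strictly positive on `closure C \ {0}`
(`exists_inner_pos`). The function `L(y) = ∫_C exp(-⟨x, y⟩) dx` is finite at such `y`, infinite at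
all others (`laplace_eq_top`), and lower semicontinuous. Its minimum over the compact unit sphere is
therefore attained at a point `p` of the open dual cone (`exists_minimizer`), where the first
variation gives `∫_C ⟨x, v⟩ exp(-⟨x, p⟩) dx = 0` for all `v ⟂ p`. Slicing `C` by the height `s = ⟨x,
p⟩` turns this integral into a positive multiple of `∫_A ⟨a, v⟩ da`, where `A = π_p(Ω)` is the slice
at height 1 (`setIntegral_slice_eq_zero`). Thus `A` has centroid 0. A bounded open convex set
contains its centroid, so `p ∈ Ω` (`hasCentroid_slice`). -/

theorem integrable_one_add_norm_mul_exp {c : ℝ} (hc : 0 < c) :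
    Integrable (fun x : E => (1 + ‖x‖) * Real.exp (-(c * ‖x‖))) := by
  -- `(1 + ‖x‖)^(-N)` is integrable because `N` exceeds the dimension; the degree `N + 1` term of
  -- the exponential series also absorbs the factor `1 + ‖x‖`.
  set N : ℕ := Module.finrank ℝ E + 1 with hN
  have h1 : Integrable (fun x : E => (1 + ‖x‖) ^ (-(N : ℝ))) :=
    integrable_one_add_norm (by rw [hN]; push_cast; linarith)
  refine (h1.const_mul (Real.exp c * (N + 1).factorial / c ^ (N + 1))).mono'
    (by fun_prop) (ae_of_all _ fun x => ?_)
  have hx : 0 < 1 + ‖x‖ := by positivity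
  have h2 := Real.pow_div_factorial_le_exp (c * (1 + ‖x‖)) (by positivity) (N + 1)
  rw [Real.norm_of_nonneg (by positivity), Real.rpow_neg hx.le, Real.rpow_natCast]
  rw [div_le_iff₀ (by positivity), mul_pow, mul_add c, mul_one, Real.exp_add] at h2
  rw [Real.exp_neg, ← div_eq_mul_inv, ← div_eq_mul_inv, div_div, div_le_div_iff₀ (by positivity) (by positivity)]
  calc (1 + ‖x‖) * (c ^ (N + 1) * (1 + ‖x‖) ^ N) = c ^ (N + 1) * (1 + ‖x‖) ^ (N + 1) := by ring
    _ ≤ _ := h2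
    _ = _ := by ring

/-- The characteristic function (Laplace transform) of a set `C`. -/
noncomputable def laplace (C : Set E) (y : E) : ENNReal :=
  ∫⁻ x in C, ENNReal.ofReal (Real.exp (-inner ℝ x y))

/-- Fatou's lemma along `𝓝 y`, the integrand being continuous in `y`. -/
theorem lowerSemicontinuous_laplace (C : Set E) : LowerSemicontinuous (laplace C) := by
  rw [lowerSemicontinuous_iff_le_liminf]
  intro y
  refine le_trans (le_of_eq ?_) (lintegral_liminf_le (u := 𝓝 y)
    (f := fun y x => ENNReal.ofReal (Real.exp (-inner ℝ x y))) fun z => by fun_prop)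
  refine lintegral_congr fun x => ?_
  have h : Continuous fun y : E => ENNReal.ofReal (Real.exp (-inner ℝ x y)) :=
    ENNReal.continuous_ofReal.comp (by fun_prop)
  exact (h.tendsto y).liminf_eq.symm

omit [FiniteDimensional ℝ E] [MeasurableSpace E] [BorelSpace E] in
theorem add_mem_of_mem_closure {C : Set E} (hopen : IsOpen C) (hconv : Convex ℝ C)
    (hcone : ∀ x ∈ C, ∀ s : ℝ, 0 < s → s • x ∈ C) {x y : E} (hx : x ∈ C) (hy : y ∈ closure C) :
    x + y ∈ C := by
  have h := hconv.combo_interior_closure_mem_interior (x := x) (y := y) (a := 1 / 2) (b := 1 / 2)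
    (by rwa [hopen.interior_eq]) hy (by norm_num) (by norm_num) (by norm_num)
  rw [hopen.interior_eq] at h
  have h2 := hcone _ h 2 (by norm_num)
  rwa [smul_add, smul_smul, smul_smul, mul_one_div_cancel two_ne_zero, one_smul, one_smul] at h2

omit [FiniteDimensional ℝ E] [MeasurableSpace E] [BorelSpace E] in
theorem smul_mem_closure {C : Set E}
    (hcone : ∀ x ∈ C, ∀ s : ℝ, 0 < s → s • x ∈ C) {x : E} (hx : x ∈ closure C) {s : ℝ}
    (hs : 0 < s) : s • x ∈ closure C :=
  map_mem_closure (continuous_const_smul s) hx fun z hz => hcone z hz s hs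

omit [FiniteDimensional ℝ E] [MeasurableSpace E] [BorelSpace E] in
theorem zero_mem_closure {C : Set E} (hne : C.Nonempty)
    (hcone : ∀ x ∈ C, ∀ s : ℝ, 0 < s → s • x ∈ C) : (0 : E) ∈ closure C := by
  obtain ⟨x, hx⟩ := hne
  have h : Tendsto (fun s : ℝ => s • x) (𝓝[>] 0) (𝓝 0) := by
    have : Continuous fun s : ℝ => s • x := by fun_prop
    simpa using (this.tendsto 0).mono_left nhdsWithin_le_nhds
  exact mem_closure_of_tendsto h (eventually_mem_nhdsWithin.mono fun s hs => hcone x hx s hs)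

/-- Translating a small ball of `C` by the multiples `k • x₀` stays in `C` and does not increase
`⟨x, y⟩`. This gives infinitely many disjoint balls of equal volume on which the integrand has a
common positive lower bound. -/
theorem laplace_eq_top {C : Set E} (hopen : IsOpen C) (hconv : Convex ℝ C)
    (hcone : ∀ x ∈ C, ∀ s : ℝ, 0 < s → s • x ∈ C) (hne : C.Nonempty) {x₀ y : E}
    (hx₀ : x₀ ∈ closure C) (h0 : x₀ ≠ 0) (hy : inner ℝ x₀ y ≤ 0) : laplace C y = ⊤ := by
  obtain ⟨c, hc⟩ := hne
  obtain ⟨ε₀, hε₀, hball⟩ := Metric.isOpen_iff.1 hopen c hc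
  have hn : 0 < ‖x₀‖ := norm_pos_iff.2 h0
  -- Distinct centres are at least `‖x₀‖` apart, so radius `‖x₀‖ / 2` keeps the balls disjoint.
  set ε := min ε₀ (‖x₀‖ / 2) with hε
  have hεpos : 0 < ε := lt_min hε₀ (by positivity)
  have hmem : ∀ k : ℕ, (k : ℝ) • x₀ ∈ closure C := fun k => by
    rcases Nat.eq_zero_or_pos k with rfl | hk
    · simpa using zero_mem_closure ⟨c, hc⟩ hcone
    · exact smul_mem_closure hcone hx₀ (by exact_mod_cast hk)
  let B : ℕ → Set E := fun k => Metric.ball (c + (k : ℝ) • x₀) ε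
  have hB : ∀ k, ∀ x ∈ B k, x - (k : ℝ) • x₀ ∈ Metric.ball c ε := fun k x hx => by
    rw [Metric.mem_ball, dist_eq_norm] at hx ⊢
    convert hx using 2
    abel
  have hsub : (⋃ k, B k) ⊆ C := by
    refine iUnion_subset fun k x hx => ?_
    have := add_mem_of_mem_closure hopen hconv hcone
      (hball (Metric.ball_subset_ball (min_le_left _ _) (hB k x hx))) (hmem k)
    simpa using this
  have hdisj : Pairwise (Function.onFun Disjoint B) := by
    intro j k hjk
    refine Metric.ball_disjoint_ball ?_
    have h1 : (1 : ℝ) ≤ |(j : ℝ) - k| := by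
      have : (1 : ℤ) ≤ |(j : ℤ) - k| := Int.one_le_abs (sub_ne_zero.2 (by exact_mod_cast hjk))
      exact_mod_cast this
    rw [dist_add_left, dist_eq_norm, ← sub_smul, norm_smul, Real.norm_eq_abs]
    have h2 : ε ≤ ‖x₀‖ / 2 := min_le_right _ _
    nlinarith
  have hbound : ∀ k, ∀ x ∈ B k, ENNReal.ofReal (Real.exp (-((‖c‖ + ε) * ‖y‖))) ≤
      ENNReal.ofReal (Real.exp (-inner ℝ x y)) := fun k x hx => by
    refine ENNReal.ofReal_le_ofReal (Real.exp_le_exp.2 (neg_le_neg ?_))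
    have h1 := hB k x hx
    have h2 : inner ℝ x y = inner ℝ (x - (k : ℝ) • x₀) y + k * inner ℝ x₀ y := by
      rw [inner_sub_left, real_inner_smul_left]; ring
    have h3 : (k : ℝ) * inner ℝ x₀ y ≤ 0 := mul_nonpos_of_nonneg_of_nonpos (Nat.cast_nonneg k) hy
    have h4 : ‖x - (k : ℝ) • x₀‖ ≤ ‖c‖ + ε := by
      have := norm_le_norm_add_norm_sub' (x - (k : ℝ) • x₀) c
      rw [Metric.mem_ball, dist_eq_norm] at h1
      linarith
    have h5 := real_inner_le_norm (x - (k : ℝ) • x₀) y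
    have h6 := mul_le_mul_of_nonneg_right h4 (norm_nonneg y)
    linarith
  rw [laplace, eq_top_iff]
  calc (⊤ : ENNReal)
      = ∑' _ : ℕ, ENNReal.ofReal (Real.exp (-((‖c‖ + ε) * ‖y‖))) *
          volume (Metric.ball (0 : E) ε) := by
        rw [ENNReal.tsum_const_eq_top_of_ne_zero]
        refine mul_ne_zero ?_ (Metric.measure_ball_pos _ _ hεpos).ne'
        simpa using Real.exp_pos _
    _ ≤ ∑' k, ∫⁻ x in B k, ENNReal.ofReal (Real.exp (-inner ℝ x y)) := by
        refine ENNReal.tsum_le_tsum fun k => ?_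
        rw [← Measure.addHaar_ball_center volume (c + (k : ℝ) • x₀), ← setLIntegral_const]
        exact setLIntegral_mono' Metric.isOpen_ball.measurableSet (hbound k)
    _ = ∫⁻ x in ⋃ k, B k, ENNReal.ofReal (Real.exp (-inner ℝ x y)) :=
        (lintegral_iUnion (fun k => Metric.isOpen_ball.measurableSet) hdisj _).symm
    _ ≤ _ := lintegral_mono_set hsub

omit [MeasurableSpace E] [BorelSpace E] in
theorem exists_mul_norm_le_inner {C : Set E}
    (hcone : ∀ x ∈ C, ∀ s : ℝ, 0 < s → s • x ∈ C) {y : E}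
    (hy : ∀ x ∈ closure C, x ≠ 0 → 0 < inner ℝ x y) :
    ∃ c : ℝ, 0 < c ∧ ∀ x ∈ C, c * ‖x‖ ≤ inner ℝ x y := by
  have hK : IsCompact (closure C ∩ Metric.sphere (0 : E) 1) :=
    (isCompact_sphere 0 1).inter_left isClosed_closure
  rcases (closure C ∩ Metric.sphere (0 : E) 1).eq_empty_or_nonempty with he | hne
  · refine ⟨1, one_pos, fun x hx => ?_⟩
    by_cases h0 : x = 0
    · simp [h0]
    · exfalso
      have : ‖x‖⁻¹ • x ∈ closure C ∩ Metric.sphere (0 : E) 1 :=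
        ⟨subset_closure (hcone x hx _ (by positivity)), by simp [norm_smul, h0]⟩
      rw [he] at this
      exact this
  · obtain ⟨z, hz, hmin⟩ := hK.exists_isMinOn hne
      (f := fun x => inner ℝ x y) (by fun_prop)
    refine ⟨inner ℝ z y, hy z hz.1 (ne_zero_of_mem_unit_sphere ⟨z, hz.2⟩), fun x hx => ?_⟩
    by_cases h0 : x = 0
    · simp [h0]
    · have hn : 0 < ‖x‖ := norm_pos_iff.2 h0
      have : ‖x‖⁻¹ • x ∈ closure C ∩ Metric.sphere (0 : E) 1 :=
        ⟨subset_closure (hcone x hx _ (by positivity)), by simp [norm_smul, h0]⟩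
      have h1 : inner ℝ z y ≤ inner ℝ (‖x‖⁻¹ • x) y := hmin this
      rw [real_inner_smul_left, ← div_eq_inv_mul, le_div_iff₀ hn] at h1
      exact h1

theorem integrableOn_mul_exp {C : Set E} (hC : MeasurableSet C) {y : E} {c : ℝ} (hc : 0 < c)
    (hy : ∀ x ∈ C, c * ‖x‖ ≤ inner ℝ x y) {g : E → ℝ} (hg : Continuous g) {M : ℝ}
    (hM : ∀ x, |g x| ≤ M * (1 + ‖x‖)) :
    IntegrableOn (fun x => g x * Real.exp (-inner ℝ x y)) C := by
  refine ((integrable_one_add_norm_mul_exp hc).const_mul M).integrableOn.mono' (by fun_prop) ?_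
  refine (ae_restrict_iff' hC).2 (ae_of_all _ fun x hx => ?_)
  rw [norm_mul, Real.norm_eq_abs, Real.norm_of_nonneg (Real.exp_pos _).le, ← mul_assoc]
  exact mul_le_mul (hM x) (Real.exp_le_exp.2 (neg_le_neg (hy x hx))) (Real.exp_pos _).le
    ((abs_nonneg _).trans (hM x))

theorem laplace_eq_ofReal {C : Set E} (hC : MeasurableSet C) {y : E} {c : ℝ} (hc : 0 < c)
    (hy : ∀ x ∈ C, c * ‖x‖ ≤ inner ℝ x y) :
    laplace C y = ENNReal.ofReal (∫ x in C, Real.exp (-inner ℝ x y)) := by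
  rw [laplace, ofReal_integral_eq_lintegral_ofReal _ (ae_of_all _ fun x => (Real.exp_pos _).le)]
  have := integrableOn_mul_exp hC hc hy (g := fun _ => 1) continuous_const (M := 1)
    (fun x => by simp)
  simpa [IntegrableOn] using this

/-- First variation along the great circle through `p` with velocity `v`, differentiating under the
integral sign. -/
theorem setIntegral_inner_mul_exp_eq_zero {C : Set E} (hC : MeasurableSet C) {p : E}
    (hp : ‖p‖ = 1) {c : ℝ} (hc : 0 < c) (hpos : ∀ x ∈ C, c * ‖x‖ ≤ inner ℝ x p)
    (hmin : ∀ y : E, ‖y‖ = 1 → laplace C p ≤ laplace C y) {v : E} (hv : ‖v‖ = 1)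
    (hpv : inner ℝ p v = 0) : ∫ x in C, inner ℝ x v * Real.exp (-inner ℝ x p) = 0 := by
  let γ : ℝ → E := fun t => Real.cos t • p + Real.sin t • v
  let γ' : ℝ → E := fun t => -Real.sin t • p + Real.cos t • v
  have hγ : ∀ t, HasDerivAt γ (γ' t) t := fun t =>
    ((Real.hasDerivAt_cos t).smul_const p).add ((Real.hasDerivAt_sin t).smul_const v)
  have hγ0 : γ 0 = p := by simp [γ]
  have hγ'0 : γ' 0 = v := by simp [γ']
  have hpp : inner ℝ p p = 1 := by rw [real_inner_self_eq_norm_sq, hp, one_pow]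
  have hvv : inner ℝ v v = 1 := by rw [real_inner_self_eq_norm_sq, hv, one_pow]
  have hγn : ∀ t, ‖γ t‖ = 1 := fun t => by
    have h : ‖γ t‖ ^ 2 = 1 := by
      rw [← real_inner_self_eq_norm_sq]
      simp only [γ, inner_add_left, inner_add_right, real_inner_smul_left, real_inner_smul_right,
        real_inner_comm p v, hpv,
        hpp, hvv]
      nlinarith [Real.sin_sq_add_cos_sq t]
    nlinarith [norm_nonneg (γ t)]
  have hγ'n : ∀ t, ‖γ' t‖ ≤ 2 := fun t => by
    refine (norm_add_le _ _).trans ?_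
    rw [norm_smul, norm_smul, hp, hv, norm_neg, Real.norm_eq_abs, Real.norm_eq_abs]
    linarith [Real.abs_sin_le_one t, Real.abs_cos_le_one t]
  have hγc : Continuous γ := by fun_prop
  -- Moving `p` by less than `c / 2` costs at most half of the coercivity constant, which gives a
  -- dominating function independent of `t`.
  let s : Set ℝ := {t | ‖γ t - p‖ < c / 2}
  have hs : s ∈ 𝓝 (0 : ℝ) :=
    (isOpen_lt (by fun_prop) continuous_const).mem_nhds (by simp [hγ0, hc])
  have hsb : ∀ t ∈ s, ∀ x ∈ C, c / 2 * ‖x‖ ≤ inner ℝ x (γ t) := fun t ht x hx => by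
    have h1 := hpos x hx
    have h2 : inner ℝ x (γ t) = inner ℝ x p + inner ℝ x (γ t - p) := by
      rw [inner_sub_right]; ring
    have h3 := (abs_le.1 (abs_real_inner_le_norm x (γ t - p))).1
    have h4 : ‖x‖ * ‖γ t - p‖ ≤ ‖x‖ * (c / 2) :=
      mul_le_mul_of_nonneg_left (le_of_lt ht) (norm_nonneg x)
    linarith
  have hder := hasDerivAt_integral_of_dominated_loc_of_deriv_le (μ := volume.restrict C)
    (F := fun t x => Real.exp (-inner ℝ x (γ t)))
    (F' := fun t x => Real.exp (-inner ℝ x (γ t)) * -inner ℝ x (γ' t)) (x₀ := 0)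
    (bound := fun x => 2 * ((1 + ‖x‖) * Real.exp (-(c / 2 * ‖x‖)))) hs
    (Eventually.of_forall fun t => by fun_prop) (by
      have := integrableOn_mul_exp hC hc hpos (g := fun _ => 1) continuous_const (M := 1)
        (fun x => by simp)
      simpa [hγ0, IntegrableOn] using this) (by fun_prop)
    ((ae_restrict_iff' hC).2 (ae_of_all _ fun x hx t ht => by
      rw [norm_mul, Real.norm_of_nonneg (Real.exp_pos _).le, norm_neg, Real.norm_eq_abs]
      have h1 : Real.exp (-inner ℝ x (γ t)) ≤ Real.exp (-(c / 2 * ‖x‖)) :=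
        Real.exp_le_exp.2 (neg_le_neg (hsb t ht x hx))
      have h2 : |inner ℝ x (γ' t)| ≤ 2 * (1 + ‖x‖) := by
        have := abs_real_inner_le_norm x (γ' t)
        nlinarith [hγ'n t, norm_nonneg x]
      calc _ ≤ Real.exp (-(c / 2 * ‖x‖)) * (2 * (1 + ‖x‖)) :=
            mul_le_mul h1 h2 (abs_nonneg _) (Real.exp_pos _).le
        _ = _ := by ring))
    ((integrable_one_add_norm_mul_exp (by positivity)).const_mul 2).integrableOn
    (ae_of_all _ fun x t _ => by
      have h := (hasDerivAt_const t x).inner ℝ (hγ t)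
      simp only [inner_zero_left, add_zero] at h
      exact h.neg.exp)
  have hloc : IsLocalMin (fun t => ∫ x in C, Real.exp (-inner ℝ x (γ t))) 0 := by
    filter_upwards [hs] with t ht
    have h := hmin (γ t) (hγn t)
    rw [laplace_eq_ofReal hC hc hpos, laplace_eq_ofReal hC (half_pos hc) (hsb t ht),
      ENNReal.ofReal_le_ofReal_iff (integral_nonneg fun x => (Real.exp_pos _).le)] at h
    simpa only [hγ0] using h
  have h0 := hloc.hasDerivAt_eq_zero hder.2
  simp only [hγ0, hγ'0, mul_neg, integral_neg, neg_eq_zero] at h0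
  simpa only [mul_comm] using h0

theorem exists_minimizer {C : Set E} (hopen : IsOpen C) (hconv : Convex ℝ C)
    (hcone : ∀ x ∈ C, ∀ s : ℝ, 0 < s → s • x ∈ C) (hne : C.Nonempty) {y₀ : E}
    (hy₀ : ∀ x ∈ closure C, x ≠ 0 → 0 < inner ℝ x y₀) (hy₀' : y₀ ≠ 0) :
    ∃ p : E, ‖p‖ = 1 ∧ (∀ x ∈ closure C, x ≠ 0 → 0 < inner ℝ x p) ∧
      ∀ v : E, inner ℝ p v = 0 → ∫ x in C, inner ℝ x v * Real.exp (-inner ℝ x p) = 0 := by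
  have hn : 0 < ‖y₀‖ := norm_pos_iff.2 hy₀'
  have hu : ‖y₀‖⁻¹ • y₀ ∈ Metric.sphere (0 : E) 1 := by simp [norm_smul, hn.ne']
  obtain ⟨p, hp, hmin⟩ := LowerSemicontinuousOn.exists_isMinOn ⟨_, hu⟩ (isCompact_sphere (0 : E) 1)
    ((lowerSemicontinuous_laplace C).lowerSemicontinuousOn _)
  have hpn : ‖p‖ = 1 := by simpa using hp
  have hfin : laplace C p < ⊤ := by
    obtain ⟨c, hc, hcy⟩ := exists_mul_norm_le_inner hcone (y := ‖y₀‖⁻¹ • y₀) fun x hx h0 => by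
      rw [real_inner_smul_right]
      exact mul_pos (by positivity) (hy₀ x hx h0)
    refine lt_of_le_of_lt (hmin hu) ?_
    rw [laplace_eq_ofReal hopen.measurableSet hc hcy]
    exact ENNReal.ofReal_lt_top
  have hpos : ∀ x ∈ closure C, x ≠ 0 → 0 < inner ℝ x p := fun x hx h0 => by
    by_contra h
    exact hfin.ne (laplace_eq_top hopen hconv hcone hne hx h0 (not_lt.1 h))
  refine ⟨p, hpn, hpos, fun v hv => ?_⟩
  obtain ⟨c, hc, hcp⟩ := exists_mul_norm_le_inner hcone hpos
  by_cases h0 : v = 0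
  · simp [h0]
  have hvn : ‖v‖ ≠ 0 := norm_ne_zero_iff.2 h0
  have h := setIntegral_inner_mul_exp_eq_zero hopen.measurableSet hpn hc hcp
    (fun y hy => hmin (by simpa using hy)) (v := ‖v‖⁻¹ • v) (by simp [norm_smul, hvn])
    (by rw [real_inner_smul_right, hv, mul_zero])
  simp only [real_inner_smul_right, mul_assoc, integral_const_mul] at h
  exact (mul_eq_zero.1 h).resolve_left (inv_ne_zero hvn)

end Analysis

/-! ### Slicing the cone by height; the centroid of the slice -/

section Fubini

variable {E : Type*} [NormedAddCommGroup E] [InnerProductSpace ℝ E] [FiniteDimensional ℝ E]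

/-- The decomposition `(s, w) ↦ s • p + w` of a Euclidean space along a unit vector `p`. -/
noncomputable def heightEquiv {p : E} (hp : ‖p‖ = 1) : (ℝ × (ℝ ∙ p)ᗮ) ≃L[ℝ] E :=
  LinearEquiv.toContinuousLinearEquiv
    { toFun := fun q => q.1 • p + q.2
      invFun := fun x => (inner ℝ x p, ⟨x - inner ℝ x p • p, by
        rw [Submodule.mem_orthogonal_singleton_iff_inner_left, inner_sub_left,
          real_inner_smul_left, real_inner_self_eq_norm_sq, hp]
        ring⟩)
      map_add' := fun q r => by simp only [Prod.fst_add, Prod.snd_add, Submodule.coe_add]; module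
      map_smul' := fun s q => by
        simp only [Prod.smul_fst, Prod.smul_snd, Submodule.coe_smul, RingHom.id_apply]; module
      left_inv := fun q => by
        have h := Submodule.mem_orthogonal_singleton_iff_inner_left.1 q.2.2
        have h1 : inner ℝ (q.1 • p + (q.2 : E)) p = q.1 := by
          rw [inner_add_left, real_inner_smul_left, real_inner_self_eq_norm_sq, hp, h]
          ring
        refine Prod.ext h1 (Subtype.ext ?_)
        simp only [h1]
        module
      right_inv := fun x => by simp }

theorem heightEquiv_apply {p : E} (hp : ‖p‖ = 1) (q : ℝ × (ℝ ∙ p)ᗮ) :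
    heightEquiv hp q = q.1 • p + q.2 := rfl

theorem inner_heightEquiv {p : E} (hp : ‖p‖ = 1) (q : ℝ × (ℝ ∙ p)ᗮ) :
    inner ℝ (heightEquiv hp q) p = q.1 := by
  rw [heightEquiv_apply, inner_add_left, real_inner_smul_left, real_inner_self_eq_norm_sq, hp,
    Submodule.mem_orthogonal_singleton_iff_inner_left.1 q.2.2]
  ring

variable [MeasurableSpace E] [BorelSpace E]

/-- The pushed-forward product measure is a Haar measure, hence a multiple of `volume`. The factor
need not be computed, since only integrability and the vanishing of an integral are transported. -/
theorem integral_heightEquiv_eq_zero {p : E} (hp : ‖p‖ = 1) {f : E → ℝ} (hf : Integrable f)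
    (h0 : ∫ x, f x = 0) :
    Integrable (fun q => f (heightEquiv hp q)) (volume.prod volume) ∧
      ∫ q, f (heightEquiv hp q) ∂(volume.prod volume) = 0 := by
  set ν := Measure.map (heightEquiv hp) (volume.prod volume) with hν
  have : ν.IsAddHaarMeasure := ContinuousLinearEquiv.isAddHaarMeasure_map _ _
  have hcν := Measure.isAddLeftInvariant_eq_smul ν (volume : Measure E)
  set c := Measure.addHaarScalarFactor ν (volume : Measure E)
  have hme : MeasurableEmbedding (heightEquiv hp) :=
    (heightEquiv hp).toHomeomorph.measurableEmbedding
  constructor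
  · have h1 : Integrable f ν := by rw [hcν]; exact hf.smul_measure_nnreal
    exact (hme.integrable_map_iff).1 h1
  · rw [← hme.integral_map, ← hν, hcν, integral_smul_nnreal_measure, h0, smul_zero]

/-- The slice of a cone `C` by the affine hyperplane at height `1` over `p`. -/
def slice (C : Set E) (p : E) : Set (ℝ ∙ p)ᗮ := {a | p + (a : E) ∈ C}

theorem setIntegral_slice_eq_zero {C : Set E} (hopen : IsOpen C)
    (hcone : ∀ x ∈ C, ∀ s : ℝ, 0 < s → s • x ∈ C) (h0 : (0 : E) ∉ C) {p : E} (hp : ‖p‖ = 1)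
    {c : ℝ} (hc : 0 < c) (hpos : ∀ x ∈ C, c * ‖x‖ ≤ inner ℝ x p) {v : E}
    (hv : inner ℝ p v = 0) (hint : ∫ x in C, inner ℝ x v * Real.exp (-inner ℝ x p) = 0) :
    ∫ a in slice C p, inner ℝ (a : E) v = 0 := by
  have hC := hopen.measurableSet
  set I := ∫ a in slice C p, inner ℝ (a : E) v with hI
  have hA : MeasurableSet (slice C p) :=
    (hopen.preimage (by fun_prop : Continuous fun a : (ℝ ∙ p)ᗮ => p + (a : E))).measurableSet
  have hintg : IntegrableOn (fun x => inner ℝ x v * Real.exp (-inner ℝ x p)) C :=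
    integrableOn_mul_exp hC hc hpos (by fun_prop) (M := ‖v‖) fun x => by
      have := abs_real_inner_le_norm x v
      nlinarith [norm_nonneg v]
  rw [← integral_indicator hC] at hint
  obtain ⟨hL, hL0⟩ := integral_heightEquiv_eq_zero hp (hintg.integrable_indicator hC) hint
  rw [integral_prod _ hL] at hL0
  set N := Module.finrank ℝ (ℝ ∙ p)ᗮ
  -- On the slice at height `s > 0`, put `w = s • a`: the Jacobian is `s ^ N`, and `⟨x, v⟩ = s * ⟨a,
  -- v⟩` because `v ⟂ p`. The cone has no points at height `s ≤ 0`.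
  have key : ∀ s : ℝ, ∫ w : (ℝ ∙ p)ᗮ, C.indicator
      (fun x => inner ℝ x v * Real.exp (-inner ℝ x p)) (heightEquiv hp (s, w)) =
      (Ioi (0 : ℝ)).indicator (fun s => Real.exp (-s) * s ^ (N + 1) * I) s := by
    intro s
    by_cases hs : 0 < s
    · rw [indicator_of_mem (show s ∈ Ioi (0 : ℝ) from hs)]
      have h1 := Measure.integral_comp_smul_of_nonneg (volume : Measure (ℝ ∙ p)ᗮ)
        (fun w => C.indicator
          (fun x => inner ℝ x v * Real.exp (-inner ℝ x p)) (heightEquiv hp (s, w))) s (hR := hs.le)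
      have h2 : ∀ a : (ℝ ∙ p)ᗮ, C.indicator
          (fun x => inner ℝ x v * Real.exp (-inner ℝ x p)) (heightEquiv hp (s, s • a)) =
          (slice C p).indicator (fun a => s * Real.exp (-s) * inner ℝ (a : E) v) a := by
        intro a
        have h3 : heightEquiv hp (s, s • a) = s • (p + (a : E)) := by
          rw [heightEquiv_apply, smul_add]; rfl
        have h4 : heightEquiv hp (s, s • a) ∈ C ↔ a ∈ slice C p := by
          rw [h3]
          refine ⟨fun h => ?_, fun h => hcone _ h s hs⟩
          have := hcone _ h s⁻¹ (by positivity)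
          rwa [smul_smul, inv_mul_cancel₀ hs.ne', one_smul] at this
        by_cases ha : a ∈ slice C p
        · rw [indicator_of_mem (h4.2 ha), indicator_of_mem ha, inner_heightEquiv, h3,
            real_inner_smul_left, inner_add_left, hv]
          ring
        · rw [indicator_of_notMem (fun h => ha (h4.1 h)), indicator_of_notMem ha]
      simp only [h2] at h1
      rw [integral_indicator hA, integral_const_mul, ← hI, smul_eq_mul] at h1
      have hsN : s ^ N ≠ 0 := (pow_pos hs N).ne'
      field_simp at h1
      rw [← h1]
      ring
    · rw [indicator_of_notMem (show s ∉ Ioi (0 : ℝ) from hs)]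
      refine (integral_congr_ae (ae_of_all _ fun w => ?_)).trans (integral_zero _ _)
      refine indicator_of_notMem (fun h => ?_) _
      have h1 := hpos _ h
      rw [inner_heightEquiv] at h1
      have h2 : 0 < ‖heightEquiv hp (s, w)‖ := norm_pos_iff.2 fun h3 => h0 (h3 ▸ h)
      have := mul_pos hc h2
      linarith
  simp only [key] at hL0
  rw [integral_indicator measurableSet_Ioi, integral_mul_const] at hL0
  refine (mul_eq_zero.1 hL0).resolve_left ?_
  -- The remaining factor `∫ exp(-s) s^(N+1) ds` is `Γ(N + 2) > 0`.
  have hG := Real.Gamma_eq_integral (s := (N : ℝ) + 2) (by positivity)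
  have hG' := Real.Gamma_pos_of_pos (s := (N : ℝ) + 2) (by positivity)
  rw [hG] at hG'
  refine ne_of_gt (lt_of_lt_of_eq hG' (setIntegral_congr_fun measurableSet_Ioi fun s _ => ?_))
  rw [show (N : ℝ) + 2 - 1 = ((N + 1 : ℕ) : ℝ) by push_cast; ring, Real.rpow_natCast]

theorem hasCentroid_slice {C : Set E} (hopen : IsOpen C) (hconv : Convex ℝ C)
    (hcone : ∀ x ∈ C, ∀ s : ℝ, 0 < s → s • x ∈ C) (h0 : (0 : E) ∉ C) (hne : C.Nonempty) {p : E}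
    (hp : ‖p‖ = 1) (hpos : ∀ x ∈ closure C, x ≠ 0 → 0 < inner ℝ x p)
    (hint : ∀ v : E, inner ℝ p v = 0 → ∫ x in C, inner ℝ x v * Real.exp (-inner ℝ x p) = 0) :
    p ∈ C ∧ HasCentroid (slice C p) 0 := by
  obtain ⟨c, hc, hcp⟩ := exists_mul_norm_le_inner hcone hpos
  have hcont : Continuous fun a : (ℝ ∙ p)ᗮ => p + (a : E) := by fun_prop
  have hAo : IsOpen (slice C p) := hopen.preimage hcont
  have hAc : Convex ℝ (slice C p) := by
    intro a ha b hb s t hs ht hst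
    have h := hconv ha hb hs ht hst
    have h1 : p + ((s • a + t • b : (ℝ ∙ p)ᗮ) : E) = s • (p + (a : E)) + t • (p + (b : E)) := by
      rw [Submodule.coe_add, Submodule.coe_smul, Submodule.coe_smul]
      calc _ = (s + t) • p + (s • (a : E) + t • (b : E)) := by rw [hst, one_smul]
        _ = _ := by module
    exact (congrArg (· ∈ C) h1).mpr h
  have hAne : (slice C p).Nonempty := by
    obtain ⟨x, hx⟩ := hne
    have hx0 : x ≠ 0 := fun h => h0 (h ▸ hx)
    have hs := hpos x (subset_closure hx) hx0
    set q := (heightEquiv hp).symm ((inner ℝ x p)⁻¹ • x)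
    have hq : heightEquiv hp q = (inner ℝ x p)⁻¹ • x := (heightEquiv hp).apply_symm_apply _
    have h1 : q.1 = 1 := by
      rw [← inner_heightEquiv hp q, hq, real_inner_smul_left, inv_mul_cancel₀ hs.ne']
    rw [heightEquiv_apply, h1, one_smul] at hq
    exact ⟨q.2, (congrArg (· ∈ C) hq).mpr (hcone x hx _ (by positivity))⟩
  -- At height 1 coercivity reads `c * ‖p + a‖ ≤ 1`.
  have hAb : ∀ a ∈ slice C p, ‖a‖ ≤ c⁻¹ + 1 := fun a ha => by
    have h1 := hcp _ ha
    have h2 : inner ℝ (p + (a : E)) p = 1 := by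
      rw [inner_add_left, real_inner_self_eq_norm_sq, hp,
        Submodule.mem_orthogonal_singleton_iff_inner_left.1 a.2]
      ring
    rw [h2, ← le_inv_mul_iff₀ hc, mul_one] at h1
    have h3 := norm_le_norm_add_norm_sub' (a : E) (p + (a : E))
    have h4 : ‖(a : E) - (p + (a : E))‖ = 1 := by rw [sub_add_cancel_right, norm_neg, hp]
    rw [Submodule.norm_coe] at h3
    linarith
  have hfin : volume (slice C p) < ⊤ := by
    refine lt_of_le_of_lt (measure_mono fun a ha => ?_)
      (measure_closedBall_lt_top (x := (0 : (ℝ ∙ p)ᗮ)) (r := c⁻¹ + 1))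
    simpa using hAb a ha
  have hvpos : 0 < volume (slice C p) := hAo.measure_pos volume hAne
  have hAi : IntegrableOn (fun a : (ℝ ∙ p)ᗮ => a) (slice C p) :=
    Integrable.mono' (g := fun _ => c⁻¹ + 1) (integrableOn_const hfin.ne)
      continuous_id.aestronglyMeasurable
      ((ae_restrict_iff' hAo.measurableSet).2 (ae_of_all _ hAb))
  have hI : ∫ a in slice C p, a = 0 := by
    refine ext_inner_left ℝ fun v => ?_
    rw [← integral_inner hAi, inner_zero_right]
    have h := setIntegral_slice_eq_zero hopen hcone h0 hp hc hcp (v := v)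
      (Submodule.mem_orthogonal_singleton_iff_inner_right.1 v.2)
      (hint _ (Submodule.mem_orthogonal_singleton_iff_inner_right.1 v.2))
    rw [← h]
    refine integral_congr_ae (ae_of_all _ fun a => ?_)
    simp only [Submodule.coe_inner]
    exact real_inner_comm _ _
  refine ⟨?_, ⟨hAo.measurableSet.nullMeasurableSet, hvpos, hfin, hAi, by rw [hI, smul_zero]⟩⟩
  -- If 0 were outside the slice, a linear functional would be negative throughout the slice, yet
  -- its integral there is its value at the vanishing first moment.
  by_contra hpC
  have h0A : (0 : (ℝ ∙ p)ᗮ) ∉ slice C p := fun h => hpC (by simpa [slice] using h)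
  obtain ⟨f, hf⟩ := geometric_hahn_banach_open_point hAc hAo h0A
  have hf' : ∀ a ∈ slice C p, 0 < -f a := fun a ha => by simpa using hf a ha
  have hfi : IntegrableOn (fun a => -f a) (slice C p) := (f.integrable_comp hAi).neg
  have hpos' : 0 < ∫ a in slice C p, -f a := by
    rw [setIntegral_pos_iff_support_of_nonneg_ae
      ((ae_restrict_iff' hAo.measurableSet).2 (ae_of_all _ fun a ha => (hf' a ha).le)) hfi]
    exact hvpos.trans_le (measure_mono fun a ha => ⟨(hf' a ha).ne', ha⟩)
  rw [integral_neg, f.integral_comp_comm hAi, hI, map_zero, neg_zero] at hpos'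
  exact lt_irrefl _ hpos'

end Fubini

/-! ### From projective convexity to a convex salient cone -/

section Cone

/-- The radial projection of a nonzero vector to the unit sphere. -/
noncomputable def toSph {n : ℕ} (x : Euc n) (hx : x ≠ 0) : Sph n :=
  ⟨‖x‖⁻¹ • x, by simp [norm_smul, hx]⟩

theorem cover_toSph {n : ℕ} (x : Euc n) (hx : x ≠ 0) :
    cover (toSph x hx) = Projectivization.mk ℝ x hx :=
  (Projectivization.mk_eq_mk_iff' ℝ _ _ _ _).2 ⟨‖x‖⁻¹, rfl⟩

theorem continuous_cover {n : ℕ} : Continuous (cover (n := n)) := continuous_coinduced_rng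

theorem continuous_mk {n : ℕ} {X : Type*} [TopologicalSpace X] {γ : X → Euc n}
    (hγ : Continuous γ) (h0 : ∀ t, γ t ≠ 0) :
    Continuous fun t => Projectivization.mk ℝ (γ t) (h0 t) := by
  have h : Continuous fun t => toSph (γ t) (h0 t) :=
    ((hγ.norm.inv₀ fun t => norm_ne_zero_iff.2 (h0 t)).smul hγ).subtype_mk _
  exact (continuous_cover.comp h).congr fun t => cover_toSph _ _

theorem eq_or_eq_neg_of_cover_eq {n : ℕ} {x y : Sph n} (h : cover x = cover y) :
    (x : Euc n) = y ∨ (x : Euc n) = -y := by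
  obtain ⟨a, ha⟩ := (Projectivization.mk_eq_mk_iff' ℝ _ _ _ _).1 h
  have h1 : |a| = 1 := by
    have := congrArg norm ha
    rwa [norm_smul, norm_eq_of_mem_sphere x, norm_eq_of_mem_sphere y, mul_one] at this
  rcases eq_or_eq_neg_of_abs_eq h1 with rfl | rfl
  · left; rw [← ha, one_smul]
  · right; rw [← ha, neg_one_smul]

/-- The open cone over a subset of the sphere. -/
def coneOver {n : ℕ} (Ω : Set (Sph n)) : Set (Euc n) :=
  {x | ∃ s : ℝ, 0 < s ∧ ∃ w ∈ Ω, x = s • (w : Euc n)}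

variable {n : ℕ} {Ω : Set (Sph n)}

theorem mem_coneOver {w : Sph n} (hw : w ∈ Ω) : (w : Euc n) ∈ coneOver Ω :=
  ⟨1, one_pos, w, hw, (one_smul _ _).symm⟩

theorem smul_mem_coneOver (x : Euc n) (hx : x ∈ coneOver Ω) (s : ℝ) (hs : 0 < s) :
    s • x ∈ coneOver Ω := by
  obtain ⟨t, ht, w, hw, rfl⟩ := hx
  exact ⟨s * t, mul_pos hs ht, w, hw, smul_smul _ _ _⟩

theorem zero_notMem_coneOver : (0 : Euc n) ∉ coneOver Ω := by
  rintro ⟨s, hs, w, -, h⟩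
  exact (smul_ne_zero hs.ne' (sph_ne_zero w)) h.symm

theorem mem_of_coe_mem_coneOver {w : Sph n} (hw : (w : Euc n) ∈ coneOver Ω) : w ∈ Ω := by
  obtain ⟨s, hs, z, hz, h⟩ := hw
  have h1 := congrArg norm h
  rw [norm_smul, norm_eq_of_mem_sphere w, norm_eq_of_mem_sphere z, mul_one,
    Real.norm_of_nonneg hs.le] at h1
  rw [← h1, one_smul] at h
  rwa [Subtype.ext h]

theorem mem_coneOver_iff {x : Euc n} : x ∈ coneOver Ω ↔ ∃ h : x ≠ 0, toSph x h ∈ Ω := by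
  constructor
  · intro hx
    have h0 : x ≠ 0 := fun h => zero_notMem_coneOver (h ▸ hx)
    exact ⟨h0, mem_of_coe_mem_coneOver (smul_mem_coneOver x hx _ (by positivity))⟩
  · rintro ⟨h, hx⟩
    have hn : ‖x‖ ≠ 0 := norm_ne_zero_iff.2 h
    exact ⟨‖x‖, by positivity, _, hx, by simp [toSph, smul_smul, hn]⟩

theorem isOpen_coneOver (hΩ : IsOpen Ω) : IsOpen (coneOver Ω) := by
  obtain ⟨U, hU, rfl⟩ := isOpen_induced_iff.1 hΩ
  have hc : ContinuousOn (fun x : Euc n => ‖x‖⁻¹ • x) {0}ᶜ :=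
    (continuousOn_id.norm.inv₀ fun x hx => norm_ne_zero_iff.2 hx).smul continuousOn_id
  convert hc.isOpen_inter_preimage isOpen_compl_singleton hU using 1
  ext x
  rw [mem_coneOver_iff]
  exact ⟨fun ⟨h, hx⟩ => ⟨h, hx⟩, fun ⟨h, hx⟩ => ⟨h, hx⟩⟩

/-- The preimage of `S` in the sphere splits into the two sheets `f '' S` and its antipode, told
apart by the sign of `⟨f (cover x), x⟩`. -/
theorem isOpen_image_section {S : Set (RP n)} (hS : IsOpen S) {f : RP n → Sph n}
    (hf : ContinuousOn f S) (hfs : ∀ q ∈ S, cover (f q) = q) : IsOpen (f '' S) := by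
  have hc : ContinuousOn (fun x : Sph n => inner ℝ (f (cover x) : Euc n) (x : Euc n))
      (cover ⁻¹' S) :=
    (continuous_subtype_val.comp_continuousOn
      (hf.comp continuous_cover.continuousOn (mapsTo_preimage _ _))).inner
        continuous_subtype_val.continuousOn
  convert hc.isOpen_inter_preimage (hS.preimage continuous_cover) (isOpen_Ioi (a := (0 : ℝ))) using 1
  ext x
  constructor
  · rintro ⟨q, hq, rfl⟩
    have h := hfs q hq
    refine ⟨(congrArg (· ∈ S) h).mpr hq, ?_⟩
    simp [h]
  · rintro ⟨hxS, hx⟩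
    refine ⟨cover x, hxS, ?_⟩
    rcases eq_or_eq_neg_of_cover_eq (hfs _ hxS) with h | h
    · exact Subtype.ext h
    · simp only [mem_preimage, mem_Ioi, h, inner_neg_left, real_inner_self_eq_norm_sq,
        norm_eq_of_mem_sphere] at hx
      norm_num at hx

theorem mk_mem_of_mem_coneOver {S : Set (RP n)} (hL : IsLift Ω S) {x : Euc n}
    (hx : x ∈ coneOver Ω) (h0 : x ≠ 0) : Projectivization.mk ℝ x h0 ∈ S := by
  obtain ⟨f, -, hfs, rfl⟩ := hL
  obtain ⟨h, q, hq, hx⟩ := mem_coneOver_iff.1 hx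
  rw [← cover_toSph, ← hx, hfs q hq]
  exact hq

theorem mk_mem_closure {S : Set (RP n)} (hL : IsLift Ω S) {x : Euc n}
    (hx : x ∈ closure (coneOver Ω)) (h0 : x ≠ 0) : Projectivization.mk ℝ x h0 ∈ closure S := by
  have hc : Continuous fun z : {z : Euc n // z ≠ 0} => Projectivization.mk ℝ (z : Euc n) z.2 :=
    continuous_mk continuous_subtype_val _
  have h : (⟨x, h0⟩ : {z : Euc n // z ≠ 0}) ∈ closure (Subtype.val ⁻¹' coneOver Ω) := by
    rw [closure_subtype, image_preimage_eq_of_subset]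
    · exact hx
    · exact fun z hz => ⟨⟨z, fun hz0 => zero_notMem_coneOver (hz0 ▸ hz)⟩, rfl⟩
  exact map_mem_closure hc h fun z hz => mk_mem_of_mem_coneOver hL hz z.2

/-- Two projective segments join `q` to `r`, and the one inside `S` might a priori join `f q` to `-f
r`. Continuity of the section along it excludes this. -/
theorem add_mem_coneOver {S : Set (RP n)} (hS : IsProjConvex S) (hL : IsLift Ω S)
    {w z : Sph n} (hw : w ∈ Ω) (hz : z ∈ Ω) {s t : ℝ} (hs : 0 < s) (ht : 0 < t) :
    s • (w : Euc n) + t • (z : Euc n) ∈ coneOver Ω := by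
  obtain ⟨f, hf, hfs, rfl⟩ := hL
  obtain ⟨q, hq, rfl⟩ := hw
  obtain ⟨r, hr, rfl⟩ := hz
  by_cases hqr : q = r
  · subst hqr
    rw [← add_smul]
    exact ⟨s + t, by positivity, _, ⟨q, hq, rfl⟩, rfl⟩
  obtain ⟨σ, ⟨u, v, -, -, rfl⟩, ⟨s₁, t₁, hs₁, ht₁, ha, hqa⟩, ⟨s₂, t₂, hs₂, ht₂, hb, hrb⟩, hσ⟩ :=
    hS q hq r hr
  have hq' := hfs q hq
  have hr' := hfs r hr
  obtain ⟨l, hl⟩ := (Projectivization.mk_eq_mk_iff' ℝ _ _ _ _).1 (hq'.trans hqa)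
  obtain ⟨m, hm⟩ := (Projectivization.mk_eq_mk_iff' ℝ _ _ _ _).1 (hr'.trans hrb)
  have hl0 : l ≠ 0 := by rintro rfl; exact sph_ne_zero (f q) (by rw [← hl, zero_smul])
  have hm0 : m ≠ 0 := by rintro rfl; exact sph_ne_zero (f r) (by rw [← hm, zero_smul])
  -- With this scaling `f q` and `k • f r` are both `l` times points of the cone on `u, v`, so the
  -- straight path between them projects into `σ`. The sign of `k` is what has to be determined.
  set k := l / m with hk
  have hk0 : k ≠ 0 := div_ne_zero hl0 hm0
  have hkm : k * m = l := div_mul_cancel₀ _ hm0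
  let γ : unitInterval → Euc n := fun τ =>
    (1 - (τ : ℝ)) • (f q : Euc n) + ((τ : ℝ) * k) • (f r : Euc n)
  have hγc : Continuous γ := by fun_prop
  have hγ0 : ∀ τ, γ τ ≠ 0 := fun τ h => by
    have hτ : (1 - (τ : ℝ)) ≠ 0 := fun h1 => by
      simp only [γ, h1, zero_smul, zero_add] at h
      have h2 : (τ : ℝ) = 1 := by linarith
      rw [h2, one_mul] at h
      exact smul_ne_zero hk0 (sph_ne_zero _) h
    refine hqr ?_
    rw [← hq', ← hr']
    refine (Projectivization.mk_eq_mk_iff' ℝ _ _ _ _).2 ⟨-((1 - (τ : ℝ))⁻¹ * (τ * k)), ?_⟩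
    have h1 := eq_neg_of_add_eq_zero_left h
    rw [neg_smul, mul_smul, ← smul_neg, ← h1, smul_smul, inv_mul_cancel₀ hτ, one_smul]
  have hγS : ∀ τ, Projectivization.mk ℝ (γ τ) (hγ0 τ) ∈ S := fun τ => by
    have h1 : γ τ = l • (((1 - (τ : ℝ)) * s₁ + τ * s₂) • u + ((1 - (τ : ℝ)) * t₁ + τ * t₂) • v) := by
      simp only [γ]
      rw [← hl, ← hm, smul_smul _ m, mul_assoc, hkm]
      module
    have h2 : ((1 - (τ : ℝ)) * s₁ + τ * s₂) • u + ((1 - (τ : ℝ)) * t₁ + τ * t₂) • v ≠ 0 :=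
      fun h => hγ0 τ (by rw [h1, h, smul_zero])
    have h3 := τ.2.1
    have h4 : 0 ≤ 1 - (τ : ℝ) := sub_nonneg.2 τ.2.2
    exact hσ ⟨_, _, by positivity, by positivity, h2,
      (Projectivization.mk_eq_mk_iff' ℝ _ _ _ _).2 ⟨l, h1.symm⟩⟩
  -- The section equals plus or minus the normalized path; `g` records the sign, never vanishes, and
  -- is positive at 0.
  let g : unitInterval → ℝ := fun τ =>
    inner ℝ (f (Projectivization.mk ℝ (γ τ) (hγ0 τ)) : Euc n) (γ τ)
  have hgc : Continuous g :=
    (continuous_subtype_val.comp (hf.comp_continuous (continuous_mk hγc hγ0) hγS)).inner hγc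
  have hsign : ∀ τ, (f (Projectivization.mk ℝ (γ τ) (hγ0 τ)) : Euc n) = ‖γ τ‖⁻¹ • γ τ ∨
      (f (Projectivization.mk ℝ (γ τ) (hγ0 τ)) : Euc n) = -(‖γ τ‖⁻¹ • γ τ) := fun τ =>
    eq_or_eq_neg_of_cover_eq (y := toSph (γ τ) (hγ0 τ))
      ((hfs _ (hγS τ)).trans (cover_toSph _ _).symm)
  have hn : ∀ τ, 0 < ‖γ τ‖⁻¹ * ‖γ τ‖ ^ 2 := fun τ => by
    have := norm_pos_iff.2 (hγ0 τ)
    positivity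
  have hg0 : ∀ τ, g τ ≠ 0 := fun τ => by
    have := hn τ
    rcases hsign τ with h | h
    · simp only [g, h, real_inner_smul_left, real_inner_self_eq_norm_sq]
      exact this.ne'
    · simp only [g, h, inner_neg_left, real_inner_smul_left, real_inner_self_eq_norm_sq]
      exact (neg_lt_zero.2 this).ne
  have hγzero : γ 0 = f q := by simp [γ]
  have hγone : γ 1 = k • (f r : Euc n) := by simp [γ]
  have hgzero : 0 < g 0 := by
    have h1 : Projectivization.mk ℝ (γ 0) (hγ0 0) = q := by
      rw [← hq']; simp only [hγzero]; rfl
    simp only [g]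
    rw [h1, hγzero, real_inner_self_eq_norm_sq, norm_eq_of_mem_sphere]
    norm_num
  have hgpos : ∀ τ, 0 < g τ := fun τ => by
    by_contra h
    obtain ⟨τ', h'⟩ := intermediate_value_univ τ 0 hgc ⟨not_lt.1 h, hgzero.le⟩
    exact hg0 τ' h'
  have hkpos : 0 < k := by
    have h1 : Projectivization.mk ℝ (γ 1) (hγ0 1) = r :=
      Eq.trans ((Projectivization.mk_eq_mk_iff' ℝ _ _ _ _).2 ⟨k, hγone.symm⟩) hr'
    have h2 := hgpos 1
    simp only [g] at h2
    rw [h1, hγone, real_inner_smul_right, real_inner_self_eq_norm_sq,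
      norm_eq_of_mem_sphere] at h2
    simpa using h2
  have hγmem : ∀ τ, γ τ ∈ coneOver (f '' S) := fun τ => by
    refine mem_coneOver_iff.2 ⟨hγ0 τ, _, hγS τ, Subtype.ext ?_⟩
    rcases hsign τ with h | h
    · exact h
    · have h1 := hgpos τ
      simp only [g, h, inner_neg_left, real_inner_smul_left, real_inner_self_eq_norm_sq] at h1
      linarith [hn τ]
  have hden : 0 < s + t / k := by positivity
  -- Solves `(s + t / k) * (1 - τ) = s` and `(s + t / k) * τ * k = t`.
  let τ : unitInterval := ⟨t / k / (s + t / k), by positivity, by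
    rw [div_le_one hden]; linarith⟩
  have h1 : s • (f q : Euc n) + t • (f r : Euc n) = (s + t / k) • γ τ := by
    simp only [γ, τ]
    rw [smul_add, smul_smul, smul_smul]
    congr 2 <;> field_simp
    ring
  rw [h1]
  exact smul_mem_coneOver _ (hγmem τ) _ hden

theorem convex_coneOver {S : Set (RP n)} (hS : IsProjConvex S) (hL : IsLift Ω S) :
    Convex ℝ (coneOver Ω) := by
  rw [convex_iff_forall_pos]
  rintro _ ⟨s, hs, w, hw, rfl⟩ _ ⟨t, ht, z, hz, rfl⟩ a b ha hb -
  rw [smul_smul, smul_smul]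
  exact add_mem_coneOver hS hL hw hz (by positivity) (by positivity)

/-- If `x` and `-x` both lay in the closure, so would the half-plane `α • c + β • x`, `α ≥ 0`, for
any `c` in the cone. Its image is a full projective line inside `closure S`. -/
theorem neg_notMem_closure_coneOver {S : Set (RP n)} (hS : IsProjProperlyConvex S)
    (hL : IsLift Ω S) (hopen : IsOpen (coneOver Ω)) (hne : (coneOver Ω).Nonempty) {x : Euc n}
    (hx : x ∈ closure (coneOver Ω)) (h0 : x ≠ 0) : -x ∉ closure (coneOver Ω) := by
  intro hx'
  have hconv := convex_coneOver hS.convex hL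
  obtain ⟨c, hc⟩ := hne
  have hβ : ∀ β : ℝ, β • x ∈ closure (coneOver Ω) := fun β => by
    rcases lt_trichotomy β 0 with h | rfl | h
    · have := smul_mem_closure smul_mem_coneOver hx' (neg_pos.2 h)
      rwa [smul_neg, neg_smul, neg_neg] at this
    · rw [zero_smul]
      exact zero_mem_closure ⟨c, hc⟩ smul_mem_coneOver
    · exact smul_mem_closure smul_mem_coneOver hx h
  have hadd : ∀ α β : ℝ, 0 ≤ α → α • c + β • x ∈ closure (coneOver Ω) := fun α β hα => by
    rcases hα.eq_or_lt with rfl | h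
    · rw [zero_smul, zero_add]
      exact hβ β
    · exact subset_closure (add_mem_of_mem_closure hopen hconv smul_mem_coneOver
        (smul_mem_coneOver c hc α h) (hβ β))
  -- If `c = a • x`, then `c + (-a) • x = 0` would belong to the cone.
  have hli : LinearIndependent ℝ ![x, c] := by
    rw [LinearIndependent.pair_iff' h0]
    intro a ha
    have := add_mem_of_mem_closure hopen hconv smul_mem_coneOver hc (hβ (-a))
    rw [← ha, ← add_smul, add_neg_cancel, zero_smul] at this
    exact zero_notMem_coneOver this
  refine hS.noLine {q | q.submodule ≤ Submodule.span ℝ (Set.range ![x, c])}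
    ⟨_, by rw [finrank_span_eq_card hli, Fintype.card_fin], rfl⟩ fun q hq => ?_
  induction q using Projectivization.ind with
  | h w hw =>
    have hw' : w ∈ Submodule.span ℝ (Set.range ![x, c]) :=
      hq (by rw [Projectivization.submodule_mk]; exact Submodule.mem_span_singleton_self w)
    rw [Matrix.range_cons, Matrix.range_cons, Matrix.range_empty, union_empty,
      singleton_union, Submodule.mem_span_pair] at hw'
    obtain ⟨β, α, h⟩ := hw'
    rcases le_total 0 α with hα | hα
    · refine mk_mem_closure hL ?_ hw
      rw [← h, add_comm (β • x)]
      exact hadd α β hα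
    · have h1 : -w ∈ closure (coneOver Ω) := by
        have := hadd (-α) (-β) (neg_nonneg.2 hα)
        rwa [neg_smul, neg_smul, ← neg_add, add_comm (α • c), h] at this
      have h2 := mk_mem_closure hL h1 (neg_ne_zero.2 hw)
      rwa [(Projectivization.mk_eq_mk_iff' ℝ (-w) w _ hw).2 ⟨-1, neg_one_smul _ _⟩] at h2

end Cone

/-! ### The dual cone of a salient cone has interior points -/

section Dual

variable {E : Type*} [NormedAddCommGroup E] [InnerProductSpace ℝ E] [FiniteDimensional ℝ E]

/-- Separate `-x` from the closed cone: a functional bounded below on a cone is nonnegative there.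
-/
theorem exists_nonneg_inner_pos {C : Set E} (hconv : Convex ℝ C)
    (hcone : ∀ x ∈ C, ∀ s : ℝ, 0 < s → s • x ∈ C) (hne : C.Nonempty) {x : E}
    (hx : -x ∉ closure C) :
    ∃ y : E, (∀ b ∈ closure C, 0 ≤ inner ℝ b y) ∧ 0 < inner ℝ x y := by
  obtain ⟨f, u, hu, hf⟩ := geometric_hahn_banach_point_closed hconv.closure isClosed_closure hx
  have hu0 : u < 0 := by simpa using hf 0 (zero_mem_closure hne hcone)
  have hfy : ∀ b, inner ℝ b ((InnerProductSpace.toDual ℝ E).symm f) = f b := fun b => by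
    rw [real_inner_comm, InnerProductSpace.toDual_symm_apply]
  refine ⟨(InnerProductSpace.toDual ℝ E).symm f, fun b hb => ?_, ?_⟩
  · rw [hfy]
    by_contra h
    have h1 : f b < 0 := not_le.1 h
    have h2 := hf _ (smul_mem_closure hcone hb (div_pos_of_neg_of_neg hu0 h1))
    rw [map_smul, smul_eq_mul, div_mul_cancel₀ _ h1.ne] at h2
    exact lt_irrefl _ h2
  · rw [hfy]
    rw [map_neg] at hu
    linarith

/-- Each unit vector of the closed cone has a functional, nonnegative on the cone, that is positive
near it. By compactness a finite sum of these is positive at every such vector. -/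
theorem exists_inner_pos {C : Set E} (hconv : Convex ℝ C)
    (hcone : ∀ x ∈ C, ∀ s : ℝ, 0 < s → s • x ∈ C) (hne : C.Nonempty)
    (hsal : ∀ x ∈ closure C, x ≠ 0 → -x ∉ closure C) :
    ∃ y : E, ∀ x ∈ closure C, x ≠ 0 → 0 < inner ℝ x y := by
  have hK : IsCompact (closure C ∩ Metric.sphere (0 : E) 1) :=
    (isCompact_sphere 0 1).inter_left isClosed_closure
  obtain ⟨y, -, hy⟩ := hK.induction_on
    (p := fun s => ∃ y : E, (∀ b ∈ closure C, 0 ≤ inner ℝ b y) ∧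
      ∀ x ∈ s, x ∈ closure C → 0 < inner ℝ x y)
    ⟨0, by simp, by simp⟩
    (fun s t hst ⟨y, h1, h2⟩ => ⟨y, h1, fun x hx => h2 x (hst hx)⟩)
    (fun s t ⟨y, h1, h2⟩ ⟨z, h3, h4⟩ => ⟨y + z,
      fun b hb => by rw [inner_add_right]; exact add_nonneg (h1 b hb) (h3 b hb),
      fun x hx hxC => by
        rw [inner_add_right]
        rcases hx with hx | hx
        · exact add_pos_of_pos_of_nonneg (h2 x hx hxC) (h3 x hxC)
        · exact add_pos_of_nonneg_of_pos (h1 x hxC) (h4 x hx hxC)⟩)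
    (fun x hx => by
      obtain ⟨y, h1, h2⟩ := exists_nonneg_inner_pos hconv hcone hne
        (hsal x hx.1 (ne_zero_of_mem_unit_sphere ⟨x, hx.2⟩))
      exact ⟨{z | 0 < inner ℝ z y}, mem_nhdsWithin_of_mem_nhds
        ((isOpen_lt continuous_const (by fun_prop)).mem_nhds h2), y, h1, fun z hz _ => hz⟩)
  refine ⟨y, fun x hx h0 => ?_⟩
  have hn : 0 < ‖x‖ := norm_pos_iff.2 h0
  have h1 := smul_mem_closure hcone hx (inv_pos.2 hn)
  have h2 := hy _ ⟨h1, by simp [norm_smul, hn.ne']⟩ h1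
  rw [real_inner_smul_left] at h2
  exact pos_of_mul_pos_right h2 (inv_pos.2 hn).le

end Dual

/-- For `x ∈ Ω`, `p + π_p(x) = x / ⟨x, p⟩` is the point at height 1 on the ray through `x`. -/
theorem radialProj_image {n : ℕ} {Ω : Set (Sph n)} {p : Sph n}
    (hpos : ∀ x ∈ Ω, 0 < inner ℝ (x : Euc n) (p : Euc n)) :
    radialProj p '' Ω = slice (coneOver Ω) (p : Euc n) := by
  ext a
  constructor
  · rintro ⟨x, hx, rfl⟩
    have h := hpos x hx
    refine ⟨(inner ℝ (x : Euc n) (p : Euc n))⁻¹, inv_pos.2 h, x, hx, ?_⟩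
    simp only [radialProj]
    rw [smul_sub, smul_smul, inv_mul_cancel₀ h.ne', one_smul]
    abel
  · rintro ⟨s, hs, x, hx, h⟩
    refine ⟨x, hx, Subtype.ext ?_⟩
    have h1 : s * inner ℝ (x : Euc n) (p : Euc n) = 1 := by
      rw [← real_inner_smul_left, ← h, inner_add_left, real_inner_self_eq_norm_sq,
        norm_eq_of_mem_sphere p, Submodule.mem_orthogonal_singleton_iff_inner_left.1 a.2]
      norm_num
    have h2 : (inner ℝ (x : Euc n) (p : Euc n))⁻¹ = s := (eq_inv_of_mul_eq_one_left h1).symm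
    simp only [radialProj]
    rw [h2, smul_sub, ← h, smul_smul, h1, one_smul]
    abel

end SphericalCenter

theorem mainTheorem6 (n : ℕ) (Ω : Set (SphericalCenter.Sph n))
    (hΩ : SphericalCenter.IsProperlyConvex Ω) (hint : (interior Ω).Nonempty) :
    ∃ p ∈ Ω, SphericalCenter.IsCenter Ω p := by
  open SphericalCenter in
  obtain ⟨S, hS, hL⟩ := hΩ
  have hΩo : IsOpen Ω := by
    obtain ⟨f, hf, hfs, rfl⟩ := hL
    exact isOpen_image_section hS.isOpen hf hfs
  have hne : (coneOver Ω).Nonempty := by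
    obtain ⟨w, hw⟩ := hint
    exact ⟨_, mem_coneOver (interior_subset hw)⟩
  have hopen := isOpen_coneOver hΩo
  have hconv := convex_coneOver hS.convex hL
  have hsal := fun x hx h0 => neg_notMem_closure_coneOver hS hL hopen hne (x := x) hx h0
  obtain ⟨y, hy⟩ := exists_inner_pos hconv smul_mem_coneOver hne hsal
  have hy0 : y ≠ 0 := by
    rintro rfl
    obtain ⟨c, hc⟩ := hne
    have := hy c (subset_closure hc) fun h => zero_notMem_coneOver (h ▸ hc)
    rw [inner_zero_right] at this
    exact lt_irrefl _ this
  obtain ⟨p, hp, hpos, hcrit⟩ := exists_minimizer hopen hconv smul_mem_coneOver hne hy hy0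
  obtain ⟨hpC, hcent⟩ := hasCentroid_slice hopen hconv smul_mem_coneOver zero_notMem_coneOver hne
    hp hpos hcrit
  have hdual : ∀ x ∈ closure Ω, 0 < inner ℝ (x : Euc n) p := fun x hx =>
    hpos x (map_mem_closure continuous_subtype_val hx fun w hw => mem_coneOver hw) (sph_ne_zero x)
  let p' : Sph n := ⟨p, by simpa using hp⟩
  refine ⟨p', mem_of_coe_mem_coneOver hpC, hdual, ?_⟩
  rw [radialProj_self, radialProj_image (p := p') fun x hx => hdual x (subset_closure hx)]
  exact hcent
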